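/- Let $M$ be a smooth manifold of dimension $n\ge 2$ and let $F:TM\to\mathbb R$ be a (positive definite) Finsler structure: $F\ge 0$, $F(x,y)=0$ iff $y=0$, $F$ is $C^\infty$ on $TM\setminus 0$, $F(x,\lambda y)=\lambda F(x,y)$ for $\lambda>0$, and $g_{ij}=\frac12\dot\partial_i\dot\partial_jF^2$ is positive definite on $TM\setminus 0$, where $\dot\partial_i=\partial/\partial y^i$. Put $\ell_i=\dot\partial_iF$, $h_{ij}=g_{ij}-\ell_i\ell_j$, $C_{ijk}=\frac12\dot\partial_kg_{ij}$, $C^h_{ij}=C_{ijk}g^{kh}$, $C_k=C_{ijk}g^{ij}$, $C_{ijkh}=\dot\partial_hC_{ijk}$ and $$T_{rijk}=FC_{rijk}-F(C_{sij}C^s_{rk}+C_{sjr}C^s_{ik}+C_{sir}C^s_{jk})+C_{rij}\ell_k+C_{rik}\ell_j+C_{rjk}\ell_i+C_{ijk}\ell_r,\qquad T^r_{jkh}=g^{ri}T_{ijkh}.$$ Assume that $F$ is C-reducible, i.e. $C_{ijk}=\frac1{n+1}(h_{ij}C_k+h_{jk}C_i+h_{ki}C_j)$ on $TM\setminus 0$.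 For a smooth function $\sigma:M\to\mathbb R$ write $\sigma_r=\partial\sigma/\partial x^r$. Call $F$ Riemannian at $x$ if $F(x,\cdot)^2$ is a quadratic form on $T_xM$. **Theorem.** (1) If $M$ is connected and $F$ is Riemannian at no point of $M$, then there is no non-constant smooth function $\sigma$ on $M$ such that $\sigma_rT^r_{jkh}=0$ on $TM\setminus 0$. (2) More precisely, without these two assumptions: if $\sigma$ is a smooth function on $M$ and $x\in M$ is a point such that $\sigma_rT^r_{jkh}(x,y)=0$ for all $y\in T_xM\setminus\{0\}$, and $F$ is not Riemannian at $x$, then $d\sigma_x=0$. -/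

import Mathlib

open scoped Manifold ContDiff

noncomputable section

namespace FinslerGeometry

/-- The model space `ℝⁿ`, with coordinates `y¹, …, yⁿ`. -/
abbrev Coord (n : ℕ) : Type := EuclideanSpace ℝ (Fin n)

/-- The partial derivative `∂f/∂yⁱ` of a function on `ℝⁿ`. -/
def partialY {n : ℕ} (i : Fin n) (f : Coord n → ℝ) (y : Coord n) : ℝ :=
  fderiv ℝ f y (EuclideanSpace.single i 1)

section Slit

variable {n : ℕ} {M : Type*} [TopologicalSpace M] [ChartedSpace (Coord n) M]
  [IsManifold (𝓡 n) ∞ M]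

/-- The restriction of `F : TM → ℝ` to the tangent space at `x`. The tangent space at `x` is `ℝⁿ`
through the basis `∂/∂x¹, …, ∂/∂xⁿ` of the preferred chart at `x`; all the objects below are tensors
on the tangent space, written in the components of that basis. -/
def onFibre (F : TangentBundle (𝓡 n) M → ℝ) (x : M) : Coord n → ℝ :=
  fun y => F ⟨x, y⟩

/-- `g_{ij}(x,y) = ½ ∂²F²/∂yⁱ∂yʲ`, as a matrix. -/
def metricMatrix (F : TangentBundle (𝓡 n) M → ℝ) (x : M) (y : Coord n) :
    Matrix (Fin n) (Fin n) ℝ :=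
  Matrix.of fun i j =>
    (1 / 2) * partialY i (fun z => partialY j (fun w => onFibre F x w ^ 2) z) y

/-- A Finsler structure on the smooth manifold `M`: nonnegative and vanishing only on the zero
section, smooth on the slit tangent bundle, positively homogeneous of degree one on the fibres,
and with a positive definite metric tensor at each point of the slit tangent bundle. -/
structure IsFinslerStructure (F : TangentBundle (𝓡 n) M → ℝ) : Prop where
  nonneg : ∀ p, 0 ≤ F p
  eq_zero_iff : ∀ p : TangentBundle (𝓡 n) M, F p = 0 ↔ p.2 = 0
  smooth : ContMDiffOn (𝓡 n).tangent 𝓘(ℝ, ℝ) ∞ F {p | p.2 ≠ 0}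
  homogeneous : ∀ (x : M) (y : TangentSpace (𝓡 n) x) (c : ℝ), 0 < c →
    F ⟨x, c • y⟩ = c * F ⟨x, y⟩
  posDef : ∀ (x : M) (y : Coord n), y ≠ 0 → (metricMatrix F x y).PosDef

/-- The components `g^{ij}(x,y)` of the inverse metric tensor. -/
def inverseMetric (F : TangentBundle (𝓡 n) M → ℝ) (x : M) (y : Coord n) (i j : Fin n) : ℝ :=
  (metricMatrix F x y)⁻¹ i j

/-- The normalized supporting element `ℓ_i = ∂F/∂yⁱ`. -/
def supportElt (F : TangentBundle (𝓡 n) M → ℝ) (x : M) (y : Coord n) (i : Fin n) : ℝ :=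
  partialY i (onFibre F x) y

/-- The angular metric tensor `h_{ij} = g_{ij} - ℓ_i ℓ_j`. -/
def angularMetric (F : TangentBundle (𝓡 n) M → ℝ) (x : M) (y : Coord n) (i j : Fin n) : ℝ :=
  metricMatrix F x y i j - supportElt F x y i * supportElt F x y j

/-- The Cartan tensor `C_{ijk} = ½ ∂g_{ij}/∂yᵏ`. -/
def cartan (F : TangentBundle (𝓡 n) M → ℝ) (x : M) (y : Coord n) (i j k : Fin n) : ℝ :=
  (1 / 2) * partialY k (fun z => metricMatrix F x z i j) y

/-- `C^h_{ij} = C_{ijk} g^{kh}`. -/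
def cartanUp (F : TangentBundle (𝓡 n) M → ℝ) (x : M) (y : Coord n) (h i j : Fin n) : ℝ :=
  ∑ k, cartan F x y i j k * inverseMetric F x y k h

/-- `C_{ijkh} = ∂C_{ijk}/∂yʰ`. -/
def cartanDeriv (F : TangentBundle (𝓡 n) M → ℝ) (x : M) (y : Coord n) (i j k h : Fin n) : ℝ :=
  partialY h (fun z => cartan F x z i j k) y

/-- The mean Cartan tensor `C_k = C_{ijk} g^{ij}`. -/
def meanCartan (F : TangentBundle (𝓡 n) M → ℝ) (x : M) (y : Coord n) (k : Fin n) : ℝ :=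
  ∑ i, ∑ j, cartan F x y i j k * inverseMetric F x y i j

/-- The T-tensor
`T_{rijk} = F C_{rijk} - F (C_{sij} C^s_{rk} + C_{sjr} C^s_{ik} + C_{sir} C^s_{jk})
  + C_{rij} ℓ_k + C_{rik} ℓ_j + C_{rjk} ℓ_i + C_{ijk} ℓ_r`. -/
def tTensor (F : TangentBundle (𝓡 n) M → ℝ) (x : M) (y : Coord n) (r i j k : Fin n) : ℝ :=
  onFibre F x y * cartanDeriv F x y r i j k
    - onFibre F x y * ∑ s, (cartan F x y s i j * cartanUp F x y s r k
        + cartan F x y s j r * cartanUp F x y s i k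
        + cartan F x y s i r * cartanUp F x y s j k)
    + cartan F x y r i j * supportElt F x y k
    + cartan F x y r i k * supportElt F x y j
    + cartan F x y r j k * supportElt F x y i
    + cartan F x y i j k * supportElt F x y r

/-- `T^r_{jkh} = g^{ri} T_{ijkh}`. -/
def tTensorUp (F : TangentBundle (𝓡 n) M → ℝ) (x : M) (y : Coord n) (r j k h : Fin n) : ℝ :=
  ∑ i, inverseMetric F x y r i * tTensor F x y i j k h

/-- The C-reducibility identity
`C_{ijk} = (h_{ij} C_k + h_{jk} C_i + h_{ki} C_j) / (n + 1)` on the slit tangent bundle. -/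
def IsCReducible (F : TangentBundle (𝓡 n) M → ℝ) : Prop :=
  ∀ (x : M) (y : Coord n), y ≠ 0 → ∀ i j k : Fin n,
    cartan F x y i j k = (1 / ((n : ℝ) + 1)) *
      (angularMetric F x y i j * meanCartan F x y k
        + angularMetric F x y j k * meanCartan F x y i
        + angularMetric F x y k i * meanCartan F x y j)

/-- `F` is Riemannian at `x`: `F(x,·)²` is a quadratic form on the tangent space at `x`. -/
def IsRiemannianAt (F : TangentBundle (𝓡 n) M → ℝ) (x : M) : Prop :=
  ∃ Q : QuadraticForm ℝ (TangentSpace (𝓡 n) x),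
    ∀ y : TangentSpace (𝓡 n) x, F ⟨x, y⟩ ^ 2 = Q y

/-- `σ_r = ∂σ/∂xʳ`. -/
def gradComp (σ : M → ℝ) (x : M) (r : Fin n) : ℝ :=
  mfderiv (𝓡 n) 𝓘(ℝ, ℝ) σ x (EuclideanSpace.single r 1 : Coord n)

/-- The condition `σ_r T^r_{jkh} = 0` on the tangent space at `x`. -/
def SigmaTVanishesAt (F : TangentBundle (𝓡 n) M → ℝ) (σ : M → ℝ) (x : M) : Prop :=
  ∀ y : Coord n, y ≠ 0 → ∀ j k h : Fin n,
    ∑ r, gradComp σ x r * tTensorUp F x y r j k h = 0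

end Slit

end FinslerGeometry

end

/-! Everything happens on one tangent space. Write `c` for the mean Cartan covector and `C² = g^{ij}
c_i c_j`. Differentiating the C-reducibility identity turns the T-tensor into `(n+1) T_{rijk} =
h_{ri} A_{jk} + h_{ij} A_{rk} + h_{jr} A_{ik}` with `A = reducedTensor` (`tTensor_eq`).

Suppose `s = dσ_x ≠ 0` annihilates T. Where `s` is not proportional to `ℓ`, contracting this formula
with `s` and taking a trace forces `A = 0` (`eq_zero_of_contraction`, `reducedTensor_eq_zero`). A
nonzero `s` cannot be proportional to `ℓ` on an open set of directions
(`covector_eq_zero_of_eventually`), so by continuity `A = 0` at every `y ≠ 0`.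

The equation `A = 0` is a differential equation for `c`; it implies that `F² C²` is constant on the
punctured tangent space (`partialY_sq_mul_meanCartanSq`). The constant is zero: `det g` is
homogeneous of degree 0, hence attains a maximum, and `c = ½ d log det g` vanishes there
(`exists_meanCartan_eq_zero`). So `C² = 0`, hence `c = 0` by positivity, the Cartan tensor vanishes
by C-reducibility, `g` is constant and `F²` is quadratic. Thus `dσ_x ≠ 0` is possible only where `F`
is Riemannian; the global statement follows by connectedness of `M`. -/

noncomputable section

namespace FinslerGeometry

/-! ### Pointwise tensor algebra -/

section Algebra

open Matrix

variable {n : ℕ}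

/-- Contracting with the inverse matrix undoes lowering an index. -/
theorem toBilin'_inv_row {g : Matrix (Fin n) (Fin n) ℝ} (hg : IsUnit g.det) (i : Fin n)
    (v : Fin n → ℝ) : toBilin' g⁻¹ (g i) v = v i := by
  rw [toBilin'_apply']
  have : g i ⬝ᵥ g⁻¹ *ᵥ v = (g *ᵥ (g⁻¹ *ᵥ v)) i := rfl
  rw [this, mulVec_mulVec, mul_nonsing_inv _ hg, one_mulVec]

theorem toBilin'_inv_mulVec {g : Matrix (Fin n) (Fin n) ℝ} (hg : IsUnit g.det) (hs : g.IsSymm)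
    (y v : Fin n → ℝ) : toBilin' g⁻¹ (g *ᵥ y) v = y ⬝ᵥ v := by
  rw [toBilin'_apply', ← vecMul_transpose, hs.eq, ← dotProduct_mulVec, mulVec_mulVec,
    mul_nonsing_inv _ hg, one_mulVec]

theorem toBilin'_comm {G : Matrix (Fin n) (Fin n) ℝ} (hs : G.IsSymm) (u v : Fin n → ℝ) :
    toBilin' G u v = toBilin' G v u := by
  rw [toBilin'_apply', toBilin'_apply', dotProduct_comm, ← vecMul_transpose, hs.eq,
    dotProduct_mulVec]

/-- The T-tensor of a C-reducible structure, computed from `h`, `ℓ`, the mean Cartan covector `c`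
and its derivative `D`, in terms of a bilinear form `B` playing the role of the inverse metric. -/
theorem tTensor_algebra {ι : Type*} (B : LinearMap.BilinForm ℝ (ι → ℝ)) (h D : ι → ι → ℝ)
    (c l : ι → ℝ) (f N : ℝ) (hN : N ≠ 0) (hf : f ≠ 0)
    (hsymm : ∀ i j, h i j = h j i) (Bhh : ∀ i j, B (h i) (h j) = h i j)
    (Bhc : ∀ i, B (h i) c = c i) (Bch : ∀ i, B c (h i) = c i)
    (C : ι → ι → ι → ℝ)
    (hC : ∀ i j k, C i j k = 1 / N * (h i j * c k + h j k * c i + h k i * c j)) (r i j k : ι) :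
    f * (1 / N * (((2 * C r i k - (l r * h i k + l i * h r k) / f) * c j + h r i * D j k)
        + ((2 * C i j k - (l i * h j k + l j * h i k) / f) * c r + h i j * D r k)
        + ((2 * C j r k - (l j * h r k + l r * h j k) / f) * c i + h j r * D i k)))
      - f * (B (C r k) (fun s => C s i j) + B (C i k) (fun s => C s j r)
        + B (C j k) (fun s => C s i r))
      + C r i j * l k + C r i k * l j + C r j k * l i + C i j k * l r
    = 1 / N * (h r i * (f * D j k + l k * c j + l j * c k - f / N * (2 * c j * c k + B c c * h j k))
      + h i j * (f * D r k + l k * c r + l r * c k - f / N * (2 * c r * c k + B c c * h r k))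
      + h j r * (f * D i k + l k * c i + l i * c k
          - f / N * (2 * c i * c k + B c c * h i k))) := by
  -- Every slice of `C` lies in the span of `c` and the rows of `h`, on which `B` is known. The free
  -- index is last in `e1` and first in `e2`; the formula for `C` makes it symmetric.
  have e1 : ∀ a b, C a b = (1 / N) • (h a b • c + c a • h b + c b • h a) := by
    intro a b; funext m
    simp only [hC, Pi.add_apply, Pi.smul_apply, smul_eq_mul, hsymm m a]; ring
  have e2 : ∀ a b, (fun s => C s a b) = (1 / N) • (c b • h a + h a b • c + c a • h b) := by
    intro a b; funext m
    simp only [hC, Pi.add_apply, Pi.smul_apply, smul_eq_mul, hsymm m a]; ring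
  have e3 : ∀ a b p q, B (C a b) (fun s => C s p q) = 1 / N * (1 / N) *
      (h p q * h a b * B c c + 2 * h p q * c a * c b + 2 * h a b * c p * c q
        + h b q * c p * c a + h b p * c q * c a + h a p * c b * c q + h a q * c b * c p) := by
    intro a b p q
    rw [e1, e2]
    simp only [map_add, map_smul, LinearMap.add_apply, LinearMap.smul_apply, smul_eq_mul, Bhh, Bhc,
      Bch]
    ring
  rw [e3, e3, e3]
  simp only [hC]
  rw [hsymm i r, hsymm j r, hsymm j i, hsymm k r, hsymm k j, hsymm k i]
  field_simp
  ring

/-- If a vector `U` whose angular part is non-zero is annihilated by the symmetrization of `h` and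
`A`, then `A = 0`. -/
theorem eq_zero_of_contraction {g A h : Matrix (Fin n) (Fin n) ℝ} {l y U w : Fin n → ℝ} {f : ℝ}
    (hg : IsUnit g.det) (hs : g.IsSymm) (hf : f ≠ 0) (hgy : g *ᵥ y = f • l) (hly : l ⬝ᵥ y = f)
    (hh : ∀ i j, h i j = g i j - l i * l j) (hAy : ∀ k, ∑ r, A r k * y r = 0)
    (hw : ∀ i, w i = ∑ r, U r * h r i) (hw0 : w ≠ 0)
    (hT : ∀ i j k, ∑ r, U r * (h r i * A j k + h i j * A r k + h j r * A i k) = 0) :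
    A = 0 := by
  have hsymm : ∀ i j, h i j = h j i := fun i j => by rw [hh, hh, hs.apply, mul_comm (l i)]
  set a : Fin n → ℝ := fun k => ∑ r, U r * A r k with ha
  have hT' : ∀ i j k, w i * A j k + h i j * a k + w j * A i k = 0 := by
    intro i j k
    rw [← hT i j k, hw i, hw j, ha]
    simp only [Finset.sum_mul, Finset.mul_sum, ← Finset.sum_add_distrib, mul_add]
    refine Finset.sum_congr rfl fun r _ => ?_
    rw [hsymm j r]; ring
  have Bl : ∀ v, toBilin' g⁻¹ l v = (y ⬝ᵥ v) / f := by
    intro v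
    have := toBilin'_inv_mulVec hg hs y v
    rw [hgy, map_smul, LinearMap.smul_apply, smul_eq_mul] at this
    rw [← this]; field_simp
  have hrow : ∀ i, h i = g i - l i • l := fun i => by
    funext j; simp [hh]
  have Bh : ∀ i v, y ⬝ᵥ v = 0 → toBilin' g⁻¹ (h i) v = v i := by
    intro i v hv
    rw [hrow, map_sub, map_smul, LinearMap.sub_apply, LinearMap.smul_apply, Bl, hv,
      toBilin'_inv_row hg]
    simp
  have hwv : w = ∑ r, U r • h r := by
    funext i; rw [hw]; simp
  have hAk : ∀ k, y ⬝ᵥ (fun j => A j k) = 0 := fun k => by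
    rw [← hAy k]; exact Finset.sum_congr rfl fun r _ => mul_comm _ _
  -- The columns of `A` are orthogonal to `y`, and on such covectors `h` with one index raised is
  -- the identity.
  have hwA : ∀ k, toBilin' g⁻¹ w (fun j => A j k) = a k := by
    intro k
    rw [hwv, map_sum, LinearMap.sum_apply]
    refine Finset.sum_congr rfl fun r _ => ?_
    rw [map_smul, LinearMap.smul_apply, Bh r _ (hAk k), smul_eq_mul]
  have hGs : (g⁻¹).IsSymm := by
    rw [IsSymm, transpose_nonsing_inv, hs.eq]
  have htr : ∑ i, ∑ j, h i j * g⁻¹ i j = n - 1 := by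
    have h1 : ∑ i, ∑ j, g i j * g⁻¹ i j = n := by
      have : ∀ i, ∑ j, g i j * g⁻¹ i j = 1 := by
        intro i
        have := congrFun (congrFun (mul_nonsing_inv _ hg) i) i
        rw [mul_apply, one_apply_eq] at this
        rw [← this]
        exact Finset.sum_congr rfl fun j _ => by rw [hGs.apply]
      simp [this]
    have h2 : ∑ i, ∑ j, l i * l j * g⁻¹ i j = 1 := by
      have := Bl l
      rw [toBilin'_apply, dotProduct_comm, hly, div_self hf] at this
      rw [← this]
      exact Finset.sum_congr rfl fun i _ => Finset.sum_congr rfl fun j _ => by ring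
    simp only [hh, sub_mul, Finset.sum_sub_distrib, h1, h2]
  -- The trace of `hT'` over `i, j` reads `a + (n - 1) a + a = 0`.
  have ha0 : a = 0 := by
    funext k
    have e : ∑ i, ∑ j, (w i * A j k + h i j * a k + w j * A i k) * g⁻¹ i j = 0 := by
      simp [hT']
    have e1 : ∑ i, ∑ j, w i * A j k * g⁻¹ i j = a k := by
      rw [← hwA k, toBilin'_apply]
      exact Finset.sum_congr rfl fun i _ => Finset.sum_congr rfl fun j _ => by ring
    have e2 : ∑ i, ∑ j, w j * A i k * g⁻¹ i j = a k := by
      rw [← hwA k, toBilin'_comm hGs, toBilin'_apply]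
      exact Finset.sum_congr rfl fun i _ => Finset.sum_congr rfl fun j _ => by ring
    have e3 : ∑ i, ∑ j, h i j * a k * g⁻¹ i j = (n - 1) * a k := by
      rw [← htr, Finset.sum_mul]
      refine Finset.sum_congr rfl fun i _ => ?_
      rw [Finset.sum_mul]
      exact Finset.sum_congr rfl fun j _ => by ring
    simp only [add_mul, Finset.sum_add_distrib, e1, e2, e3] at e
    have hn : ((n : ℝ) + 1) ≠ 0 := by positivity
    have : ((n : ℝ) + 1) * a k = 0 := by linarith
    simpa [hn] using this
  -- With `a = 0` and `w i ≠ 0`, taking `j = i` in `hT'` gives `2 w_i A_{ik} = 0`; then row `i`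
  -- drops out for every other `j`.
  obtain ⟨i, hi⟩ := Function.ne_iff.1 hw0
  rw [Pi.zero_apply] at hi
  have hA1 : ∀ k, A i k = 0 := by
    intro k
    have := hT' i i k
    rw [ha0, Pi.zero_apply] at this
    have h2 : w i * A i k = 0 := by linarith
    simpa [hi] using h2
  ext j k
  have := hT' i j k
  rw [ha0, hA1, Pi.zero_apply] at this
  have h2 : w i * A j k = 0 := by linarith
  simpa [hi] using h2

end Algebra

/-! ### Calculus of partial derivatives on the punctured space -/

section PartialDerivatives

variable {n : ℕ} {u v : Coord n → ℝ} {y : Coord n}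

theorem partialY_congr {i : Fin n} (h : u =ᶠ[nhds y] v) : partialY i u y = partialY i v y := by
  rw [partialY, partialY, h.fderiv_eq]

theorem partialY_add {i : Fin n} (hu : DifferentiableAt ℝ u y) (hv : DifferentiableAt ℝ v y) :
    partialY i (fun z => u z + v z) y = partialY i u y + partialY i v y := by
  rw [partialY, fderiv_fun_add hu hv]; rfl

theorem partialY_sub {i : Fin n} (hu : DifferentiableAt ℝ u y) (hv : DifferentiableAt ℝ v y) :
    partialY i (fun z => u z - v z) y = partialY i u y - partialY i v y := by
  rw [partialY, fderiv_fun_sub hu hv]; rfl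

theorem partialY_mul {i : Fin n} (hu : DifferentiableAt ℝ u y) (hv : DifferentiableAt ℝ v y) :
    partialY i (fun z => u z * v z) y = u y * partialY i v y + v y * partialY i u y := by
  rw [partialY, fderiv_fun_mul hu hv]; rfl

theorem partialY_const_mul {i : Fin n} (c : ℝ) (hu : DifferentiableAt ℝ u y) :
    partialY i (fun z => c * u z) y = c * partialY i u y := by
  rw [partialY, fderiv_const_mul hu]; rfl

theorem partialY_const {i : Fin n} (c : ℝ) : partialY i (fun _ => c) y = 0 := by
  simp [partialY]

theorem partialY_sum {ι : Type*} {s : Finset ι} {i : Fin n} {w : ι → Coord n → ℝ}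
    (hw : ∀ a ∈ s, DifferentiableAt ℝ (w a) y) :
    partialY i (fun z => ∑ a ∈ s, w a z) y = ∑ a ∈ s, partialY i (w a) y := by
  rw [partialY, fderiv_fun_sum hw, sum_apply]; rfl

theorem differentiableAt_coord (j : Fin n) : DifferentiableAt ℝ (fun z : Coord n => z j) y :=
  (EuclideanSpace.proj (𝕜 := ℝ) j).differentiableAt

theorem partialY_coord (i j : Fin n) :
    partialY i (fun z : Coord n => z j) y = if j = i then 1 else 0 := by
  have : fderiv ℝ (fun z : Coord n => z j) y = EuclideanSpace.proj (𝕜 := ℝ) j :=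
    (EuclideanSpace.proj (𝕜 := ℝ) j).fderiv
  rw [partialY, this]
  simp

/-- Differentiating a contraction with the position vector. -/
theorem partialY_sum_mul_coord {w : Fin n → Coord n → ℝ}
    (hw : ∀ r, DifferentiableAt ℝ (w r) y) (k : Fin n) :
    partialY k (fun z => ∑ r, w r z * z r) y = w k y + ∑ r, partialY k (w r) y * y r := by
  rw [partialY_sum fun r _ => (hw r).fun_mul (differentiableAt_coord r)]
  have : ∀ r, partialY k (fun z => w r z * z r) y =
      (if r = k then w r y else 0) + partialY k (w r) y * y r := by
    intro r
    rw [partialY_mul (hw r) (differentiableAt_coord r), partialY_coord]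
    split_ifs <;> ring
  simp [this, Finset.sum_add_distrib]

theorem fderiv_eq_sum_partialY (w : Coord n) :
    fderiv ℝ u y w = ∑ i, partialY i u y * w i := by
  conv_lhs => rw [← (EuclideanSpace.basisFun (Fin n) ℝ).sum_repr w]
  simp [partialY, mul_comm]

theorem fderiv_eq_zero_of_partialY (h : ∀ i, partialY i u y = 0) : fderiv ℝ u y = 0 := by
  ext w; simp [fderiv_eq_sum_partialY, h]

theorem isOpen_slit : IsOpen ({0}ᶜ : Set (Coord n)) := isOpen_compl_singleton

theorem slit_mem_nhds (hy : y ≠ 0) : ({0}ᶜ : Set (Coord n)) ∈ nhds y :=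
  isOpen_slit.mem_nhds hy

theorem differentiableAt_of_slit (h : ContDiffOn ℝ ∞ u {0}ᶜ) (hy : y ≠ 0) :
    DifferentiableAt ℝ u y :=
  (h.contDiffAt (slit_mem_nhds hy)).differentiableAt (by simp)

theorem contDiffOn_partialY (h : ContDiffOn ℝ ∞ u {0}ᶜ) (i : Fin n) :
    ContDiffOn ℝ ∞ (partialY i u) {0}ᶜ :=
  (h.fderiv_of_isOpen isOpen_slit (by simp)).clm_apply contDiffOn_const

theorem continuousAt_of_slit (h : ContDiffOn ℝ ∞ u {0}ᶜ) (hy : y ≠ 0) : ContinuousAt u y :=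
  (differentiableAt_of_slit h hy).continuousAt

theorem partialY_congr_slit {i : Fin n} (hy : y ≠ 0) (h : ∀ z, z ≠ 0 → u z = v z) :
    partialY i u y = partialY i v y :=
  partialY_congr (Filter.eventually_of_mem (slit_mem_nhds hy) h)

/-- Partial derivatives of a positively homogeneous function of degree `m`. -/
theorem mul_partialY_smul {m : ℕ} {c : ℝ} (hu : ∀ z, z ≠ 0 → u (c • z) = c ^ m * u z)
    (hy : y ≠ 0) (hd : DifferentiableAt ℝ u y) (i : Fin n) :
    c * partialY i u (c • y) = c ^ m * partialY i u y := by
  -- Both sides are the derivative of `z ↦ u (c • z)`; leaving `c` on the left avoids the exponent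
  -- `m - 1`.
  rw [← partialY_const_mul _ hd, ← partialY_congr_slit hy hu, partialY, partialY,
    fderiv_comp_smul]
  rfl

/-- Dimension at least two is essential here: a punctured line is disconnected. -/
theorem isPreconnected_slit (hn : 2 ≤ n) : IsPreconnected ({0}ᶜ : Set (Coord n)) := by
  refine (isConnected_compl_singleton_of_one_lt_rank ?_ _).isPreconnected
  rw [← Module.finrank_eq_rank, finrank_euclideanSpace_fin]
  exact_mod_cast hn

theorem eq_of_partialY_eq_zero (hn : 2 ≤ n) (hu : ContDiffOn ℝ ∞ u {0}ᶜ)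
    (h : ∀ z, z ≠ 0 → ∀ i, partialY i u z = 0) {z : Coord n} (hy : y ≠ 0) (hz : z ≠ 0) :
    u y = u z :=
  isOpen_slit.is_const_of_fderiv_eq_zero (isPreconnected_slit hn)
    (hu.differentiableOn (by simp)) (fun w hw => fderiv_eq_zero_of_partialY (h w hw)) hy hz

end PartialDerivatives

/-! ### Determinants and inverses of matrix-valued functions -/

section Jacobi

open Matrix

variable {n m : ℕ}

theorem contDiffOn_det {g : Coord n → Matrix (Fin m) (Fin m) ℝ} {s : Set (Coord n)}
    (h : ∀ i j, ContDiffOn ℝ ∞ (fun z => g z i j) s) :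
    ContDiffOn ℝ ∞ (fun z => (g z).det) s := by
  simp only [det_apply']
  exact ContDiffOn.sum fun σ _ => contDiffOn_const.mul (contDiffOn_prod fun i _ => h _ _)

theorem contDiffOn_inv {g : Coord n → Matrix (Fin m) (Fin m) ℝ} {s : Set (Coord n)}
    (h : ∀ i j, ContDiffOn ℝ ∞ (fun z => g z i j) s) (hg : ∀ z ∈ s, (g z).det ≠ 0) (i j : Fin m) :
    ContDiffOn ℝ ∞ (fun z => (g z)⁻¹ i j) s := by
  simp only [inv_def, Ring.inverse_eq_inv', Matrix.smul_apply, smul_eq_mul, adjugate_apply]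
  refine ((contDiffOn_det h).inv hg).mul (contDiffOn_det fun a b => ?_)
  by_cases ha : a = j
  · subst ha
    simpa using contDiffOn_const
  · simpa [updateRow_ne ha] using h a b

/-- Jacobi's formula for the derivative of a determinant. -/
theorem partialY_det {g : Coord n → Matrix (Fin m) (Fin m) ℝ} {y : Coord n}
    (h : ∀ i j, DifferentiableAt ℝ (fun z => g z i j) y) (hg : (g y).det ≠ 0) (k : Fin n) :
    partialY k (fun z => (g z).det) y =
      (g y).det * ∑ i, ∑ j, partialY k (fun z => g z i j) y * (g y)⁻¹ j i := by
  -- The determinant is multilinear in the rows, so its derivative is a sum of determinants with one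
  -- row replaced; Cramer's rule expresses each through the adjugate.
  let D : ContinuousMultilinearMap ℝ (fun _ : Fin m => Fin m → ℝ) ℝ :=
    { (detRowAlternating : (Fin m → ℝ) [⋀^Fin m]→ₗ[ℝ] ℝ).toMultilinearMap with
      cont := (continuous_id.matrix_det :
        Continuous fun A : Matrix (Fin m) (Fin m) ℝ => A.det) }
  have hrow : ∀ i, HasFDerivAt (fun z => g z i)
      (ContinuousLinearMap.pi fun j => fderiv ℝ (fun z => g z i j) y) y := fun i =>
    hasFDerivAt_pi.2 fun j => (h i j).hasFDerivAt
  have hD : HasFDerivAt (fun z => (g z).det) _ y := HasFDerivAt.multilinear_comp (f := D) hrow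
  rw [partialY, hD.fderiv, _root_.sum_apply, Finset.mul_sum]
  refine Finset.sum_congr rfl fun i _ => ?_
  have e : ∀ b : Fin m → ℝ, D (Function.update (fun j => g y j) i b) =
      ((g y).adjugateᵀ *ᵥ b) i := by
    intro b
    rw [adjugate_transpose, ← cramer_eq_adjugate_mulVec, cramer_transpose_apply]
    rfl
  change D (Function.update (fun j => g y j) i _) = _
  rw [e, mulVec, dotProduct, Finset.mul_sum]
  refine Finset.sum_congr rfl fun j _ => ?_
  rw [transpose_apply, inv_def, Ring.inverse_eq_inv', Matrix.smul_apply, smul_eq_mul]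
  field_simp
  rfl

end Jacobi

theorem mfderiv_eq_zero_of_gradComp {n : ℕ} {M : Type*} [TopologicalSpace M]
    [ChartedSpace (Coord n) M] {σ : M → ℝ} {x : M} (h : ∀ r, gradComp (n := n) σ x r = 0) :
    mfderiv (𝓡 n) 𝓘(ℝ, ℝ) σ x = 0 := by
  have : ∀ L : Coord n →L[ℝ] ℝ, (∀ r, L (EuclideanSpace.single r 1) = 0) → L = 0 := by
    intro L hL
    ext w
    rw [← (EuclideanSpace.basisFun (Fin n) ℝ).sum_repr w]
    simp [hL]
  exact this _ h

/-! ### Passage between the manifold and its tangent spaces -/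

section Manifold

variable {n : ℕ} {M : Type*} [TopologicalSpace M] [ChartedSpace (Coord n) M]
  [IsManifold (𝓡 n) ∞ M]

theorem contMDiff_fibre_inclusion (x : M) :
    ContMDiff 𝓘(ℝ, Coord n) (𝓡 n).tangent ∞
      (fun y : Coord n => (⟨x, y⟩ : TangentBundle (𝓡 n) M)) := by
  intro y
  rw [Bundle.contMDiffAt_totalSpace]
  refine ⟨contMDiffAt_const, ?_⟩
  -- The trivialization centred at `x` is the identity on the fibre over `x`.
  have : (fun y' : Coord n => ((trivializationAt (Coord n) (TangentSpace (𝓡 n)) x)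
      (⟨x, y'⟩ : TangentBundle (𝓡 n) M)).2) = fun y' => y' := by
    funext y'
    rw [TangentBundle.trivializationAt_apply]
    exact tangentCoordChange_self (I := 𝓡 n) (mem_extChartAt_source x)
  simp only
  rw [this]
  exact contMDiffAt_id

theorem IsFinslerStructure.contDiffOn_onFibre {F : TangentBundle (𝓡 n) M → ℝ}
    (hF : IsFinslerStructure F) (x : M) : ContDiffOn ℝ ∞ (onFibre F x) {0}ᶜ := by
  rw [← contMDiffOn_iff_contDiffOn]
  exact hF.smooth.comp (contMDiff_fibre_inclusion x).contMDiffOn fun y hy => hy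

theorem exists_eq_const_of_mfderiv_eq_zero [ConnectedSpace M] {σ : M → ℝ}
    (hσ : ContMDiff (𝓡 n) 𝓘(ℝ, ℝ) ∞ σ) (h : ∀ x, mfderiv (𝓡 n) 𝓘(ℝ, ℝ) σ x = 0) :
    ∃ c, ∀ x, σ x = c := by
  have hloc : IsLocallyConstant σ := by
    rw [IsLocallyConstant.iff_eventually_eq]
    intro x
    have htar : (extChartAt (𝓡 n) x).target ∈ nhds (extChartAt (𝓡 n) x x) :=
      extChartAt_target_mem_nhds x
    -- A ball in the chart target is connected, so `σ` read in the chart is constant on it.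
    obtain ⟨r, hr, hball⟩ := Metric.mem_nhds_iff.1 htar
    have hd : ∀ z ∈ Metric.ball (extChartAt (𝓡 n) x x) r,
        HasFDerivAt (σ ∘ (extChartAt (𝓡 n) x).symm) (0 : Coord n →L[ℝ] ℝ) z := by
      intro z hz
      have h1 : MDifferentiableAt 𝓘(ℝ, Coord n) (𝓡 n) (extChartAt (𝓡 n) x).symm z :=
        ((contMDiffOn_extChartAt_symm (n := ∞) x).contMDiffAt
          ((isOpen_extChartAt_target x).mem_nhds (hball hz))).mdifferentiableAt (by simp)
      have h2 : MDifferentiableAt (𝓡 n) 𝓘(ℝ, ℝ) σ ((extChartAt (𝓡 n) x).symm z) :=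
        (hσ _).mdifferentiableAt (by simp)
      have h3 := h2.hasMFDerivAt.comp z h1.hasMFDerivAt
      rw [h, ContinuousLinearMap.zero_comp] at h3
      exact h3.hasFDerivAt
    have hc : ∀ z ∈ Metric.ball (extChartAt (𝓡 n) x x) r,
        (σ ∘ (extChartAt (𝓡 n) x).symm) z = σ x := by
      intro z hz
      have := Metric.isOpen_ball.is_const_of_fderiv_eq_zero
        (convex_ball (extChartAt (𝓡 n) x x) r).isPreconnected
        (fun w hw => (hd w hw).differentiableAt.differentiableWithinAt)
        (fun w hw => (hd w hw).fderiv) hz (Metric.mem_ball_self hr)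
      rw [this, Function.comp_apply, extChartAt_to_inv]
    filter_upwards [extChartAt_source_mem_nhds (I := 𝓡 n) x,
      (continuousAt_extChartAt (I := 𝓡 n) x).preimage_mem_nhds (Metric.ball_mem_nhds _ hr)]
      with p hp hp'
    rw [← hc _ hp', Function.comp_apply, (extChartAt (𝓡 n) x).left_inv hp]
  obtain ⟨x₀⟩ := (inferInstance : Nonempty M)
  exact ⟨σ x₀, fun x => hloc.apply_eq_of_preconnectedSpace x x₀⟩
end Manifold

/-! ### Finsler identities on one tangent space -/

section Fibre

open Matrix

variable {n : ℕ} {M : Type*} [TopologicalSpace M] [ChartedSpace (Coord n) M]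
  [IsManifold (𝓡 n) ∞ M] {F : TangentBundle (𝓡 n) M → ℝ}

namespace IsFinslerStructure

variable (hF : IsFinslerStructure F) (x : M)

include hF

theorem contDiffOn_supportElt (i : Fin n) :
    ContDiffOn ℝ ∞ (fun z => supportElt F x z i) {0}ᶜ :=
  contDiffOn_partialY (hF.contDiffOn_onFibre x) i

theorem contDiffOn_metricMatrix (i j : Fin n) :
    ContDiffOn ℝ ∞ (fun z => metricMatrix F x z i j) {0}ᶜ :=
  contDiffOn_const.mul
    (contDiffOn_partialY (contDiffOn_partialY ((hF.contDiffOn_onFibre x).pow 2) j) i)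

theorem contDiffOn_inverseMetric (i j : Fin n) :
    ContDiffOn ℝ ∞ (fun z => inverseMetric F x z i j) {0}ᶜ :=
  contDiffOn_inv (hF.contDiffOn_metricMatrix x)
    (fun z hz => (hF.posDef x z hz).det_pos.ne') i j

theorem contDiffOn_angularMetric (i j : Fin n) :
    ContDiffOn ℝ ∞ (fun z => angularMetric F x z i j) {0}ᶜ :=
  (hF.contDiffOn_metricMatrix x i j).sub
    ((hF.contDiffOn_supportElt x i).mul (hF.contDiffOn_supportElt x j))

theorem contDiffOn_cartan (i j k : Fin n) :
    ContDiffOn ℝ ∞ (fun z => cartan F x z i j k) {0}ᶜ :=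
  contDiffOn_const.mul (contDiffOn_partialY (hF.contDiffOn_metricMatrix x i j) k)

theorem contDiffOn_meanCartan (k : Fin n) :
    ContDiffOn ℝ ∞ (fun z => meanCartan F x z k) {0}ᶜ :=
  ContDiffOn.sum fun i _ => ContDiffOn.sum fun j _ =>
    (hF.contDiffOn_cartan x i j k).mul (hF.contDiffOn_inverseMetric x i j)

variable {x} {y : Coord n}

theorem onFibre_ne_zero (hy : y ≠ 0) : onFibre F x y ≠ 0 :=
  fun h => hy ((hF.eq_zero_iff ⟨x, y⟩).1 h)

theorem onFibre_smul {c : ℝ} (hc : 0 < c) (z : Coord n) :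
    onFibre F x (c • z) = c * onFibre F x z :=
  hF.homogeneous x z c hc

theorem isUnit_det (hy : y ≠ 0) : IsUnit (metricMatrix F x y).det :=
  (hF.posDef x y hy).det_pos.ne'.isUnit

theorem isSymm_metricMatrix (hy : y ≠ 0) : (metricMatrix F x y).IsSymm := by
  have := (hF.posDef x y hy).isHermitian
  rwa [IsHermitian, conjTranspose_eq_transpose_of_trivial] at this

theorem angularMetric_comm (hy : y ≠ 0) (i j : Fin n) :
    angularMetric F x y i j = angularMetric F x y j i := by
  rw [angularMetric, angularMetric, (hF.isSymm_metricMatrix hy).apply,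
    mul_comm (supportElt F x y i)]

/-- Since `½ ∂_j F² = F ℓ_j`, one more derivative gives `g_{ij} = ℓ_i ℓ_j + F ∂_i ℓ_j`. -/
theorem angularMetric_eq (hy : y ≠ 0) (i j : Fin n) :
    angularMetric F x y i j =
      onFibre F x y * partialY i (fun z => supportElt F x z j) y := by
  have hd : ∀ z : Coord n, z ≠ 0 → DifferentiableAt ℝ (onFibre F x) z := fun z hz =>
    differentiableAt_of_slit (hF.contDiffOn_onFibre x) hz
  have h1 : ∀ z : Coord n, z ≠ 0 → partialY j (fun w => onFibre F x w ^ 2) z =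
      2 * (onFibre F x z * supportElt F x z j) := by
    intro z hz
    simp only [pow_two]
    rw [partialY_mul (hd z hz) (hd z hz), supportElt]; ring
  have hl := differentiableAt_of_slit (hF.contDiffOn_supportElt x j) hy
  rw [angularMetric, metricMatrix, of_apply, partialY_congr_slit hy h1,
    partialY_const_mul _ ((hd y hy).fun_mul hl), partialY_mul (hd y hy) hl]
  simp only [supportElt]
  ring

theorem partialY_supportElt (hy : y ≠ 0) (k i : Fin n) :
    partialY k (fun z => supportElt F x z i) y = angularMetric F x y i k / onFibre F x y := by
  rw [hF.angularMetric_comm hy, hF.angularMetric_eq hy,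
    mul_div_cancel_left₀ _ (hF.onFibre_ne_zero hy)]

theorem partialY_angularMetric (hy : y ≠ 0) (i j k : Fin n) :
    partialY k (fun z => angularMetric F x z i j) y = 2 * cartan F x y i j k
      - (supportElt F x y i * angularMetric F x y j k
        + supportElt F x y j * angularMetric F x y i k) / onFibre F x y := by
  have hg := differentiableAt_of_slit (hF.contDiffOn_metricMatrix x i j) hy
  have hi := differentiableAt_of_slit (hF.contDiffOn_supportElt x i) hy
  have hj := differentiableAt_of_slit (hF.contDiffOn_supportElt x j) hy
  simp only [angularMetric]
  rw [partialY_sub hg (hi.fun_mul hj), partialY_mul hi hj, hF.partialY_supportElt hy,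
    hF.partialY_supportElt hy]
  simp only [cartan, angularMetric]
  ring

/-- Euler's identity: differentiate `F(ty) = t F(y)` at `t = 1`. -/
theorem sum_supportElt_mul (hy : y ≠ 0) : ∑ i, supportElt F x y i * y i = onFibre F x y := by
  have hd : DifferentiableAt ℝ (onFibre F x) y :=
    differentiableAt_of_slit (hF.contDiffOn_onFibre x) hy
  have e := fderiv_eq_sum_partialY (u := onFibre F x) (y := y) y
  simp only [supportElt]
  rw [← e]
  have h1 : HasDerivAt (fun t : ℝ => t • y) y 1 := by
    simpa using (hasDerivAt_id (1 : ℝ)).smul_const y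
  have h2 : HasDerivAt (fun t : ℝ => onFibre F x (t • y)) (fderiv ℝ (onFibre F x) y y) 1 := by
    have hd' : HasFDerivAt (onFibre F x) (fderiv ℝ (onFibre F x) y) ((1 : ℝ) • y) := by
      rw [one_smul]; exact hd.hasFDerivAt
    exact hd'.comp_hasDerivAt 1 h1
  have h3 : HasDerivAt (fun t : ℝ => t * onFibre F x y) (onFibre F x y) 1 := by
    simpa using (hasDerivAt_id (1 : ℝ)).mul_const (onFibre F x y)
  refine h2.unique (h3.congr_of_eventuallyEq ?_)
  filter_upwards [lt_mem_nhds (zero_lt_one (α := ℝ))] with t ht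
  exact hF.onFibre_smul ht y

theorem supportElt_dotProduct (hy : y ≠ 0) :
    supportElt F x y ⬝ᵥ (y : Fin n → ℝ) = onFibre F x y :=
  hF.sum_supportElt_mul hy

/-- Differentiating Euler's identity leaves `(∂_i ℓ_r) y^r = 0`. -/
theorem sum_angularMetric_mul (hy : y ≠ 0) (i : Fin n) :
    ∑ j, angularMetric F x y i j * y j = 0 := by
  have e := partialY_congr_slit (i := i) hy (fun z hz => hF.sum_supportElt_mul (x := x) hz)
  rw [partialY_sum_mul_coord
    (fun r => differentiableAt_of_slit (hF.contDiffOn_supportElt x r) hy)] at e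
  have e2 : ∑ r, partialY i (fun z => supportElt F x z r) y * y r = 0 := by
    simp only [supportElt] at e ⊢; linarith
  simp only [hF.angularMetric_eq hy, mul_assoc]
  rw [← Finset.mul_sum, e2, mul_zero]

theorem metricMatrix_mulVec (hy : y ≠ 0) :
    metricMatrix F x y *ᵥ (y : Fin n → ℝ) = onFibre F x y • supportElt F x y := by
  funext i
  have h := hF.sum_angularMetric_mul (x := x) hy i
  simp only [angularMetric, sub_mul, Finset.sum_sub_distrib, mul_assoc, ← Finset.mul_sum,
    hF.sum_supportElt_mul hy] at h
  rw [mulVec, dotProduct, Pi.smul_apply, smul_eq_mul]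
  linarith

/-- The inverse metric applied to `ℓ`. -/
theorem toBilin'_supportElt (hy : y ≠ 0) (v : Fin n → ℝ) :
    toBilin' (metricMatrix F x y)⁻¹ (supportElt F x y) v =
      ((y : Fin n → ℝ) ⬝ᵥ v) / onFibre F x y := by
  have h := toBilin'_inv_mulVec (hF.isUnit_det (x := x) hy) (hF.isSymm_metricMatrix hy) y v
  rw [hF.metricMatrix_mulVec hy, map_smul, LinearMap.smul_apply, smul_eq_mul] at h
  rw [← h, mul_div_cancel_left₀ _ (hF.onFibre_ne_zero hy)]

theorem toBilin'_angularMetric (hy : y ≠ 0) (i : Fin n) (v : Fin n → ℝ) :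
    toBilin' (metricMatrix F x y)⁻¹ (angularMetric F x y i) v =
      v i - supportElt F x y i * (((y : Fin n → ℝ) ⬝ᵥ v) / onFibre F x y) := by
  have : angularMetric F x y i =
      metricMatrix F x y i - supportElt F x y i • supportElt F x y := by
    funext j; simp [angularMetric]
  rw [this, map_sub, map_smul, LinearMap.sub_apply, LinearMap.smul_apply,
    hF.toBilin'_supportElt hy, toBilin'_inv_row (hF.isUnit_det hy), smul_eq_mul]

theorem isSymm_inverse (hy : y ≠ 0) : ((metricMatrix F x y)⁻¹).IsSymm := by
  rw [IsSymm, transpose_nonsing_inv, (hF.isSymm_metricMatrix hy).eq]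

theorem sum_angularMetric_inverseMetric (hy : y ≠ 0) :
    ∑ i, ∑ j, angularMetric F x y i j * inverseMetric F x y i j = n - 1 := by
  have h1 : ∀ i, ∑ j, metricMatrix F x y i j * inverseMetric F x y i j = 1 := by
    intro i
    have := congrFun (congrFun (mul_nonsing_inv _ (hF.isUnit_det (x := x) hy)) i) i
    rw [mul_apply, one_apply_eq] at this
    rw [← this]
    exact Finset.sum_congr rfl fun j _ => by rw [inverseMetric, (hF.isSymm_inverse hy).apply]
  have h2 : ∑ i, ∑ j, supportElt F x y i * supportElt F x y j * inverseMetric F x y i j = 1 := by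
    have := hF.toBilin'_supportElt hy (x := x) (supportElt F x y)
    rw [toBilin'_apply, dotProduct_comm, hF.supportElt_dotProduct hy,
      div_self (hF.onFibre_ne_zero hy)] at this
    rw [← this]
    exact Finset.sum_congr rfl fun i _ => Finset.sum_congr rfl fun j _ => by
      rw [inverseMetric]; ring
  simp only [angularMetric, sub_mul, Finset.sum_sub_distrib, h1, h2]
  simp

/-- The mean Cartan covector of a C-reducible structure annihilates `y`. -/
theorem sum_meanCartan_mul (hC : IsCReducible F) (hy : y ≠ 0) :
    ∑ k, meanCartan F x y k * y k = 0 := by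
  set c := meanCartan F x y with hc
  have hB : ∀ i, toBilin' (metricMatrix F x y)⁻¹ (angularMetric F x y i) c =
      c i - supportElt F x y i * (((y : Fin n → ℝ) ⬝ᵥ c) / onFibre F x y) :=
    fun i => hF.toBilin'_angularMetric hy i c
  have hN : (n : ℝ) + 1 ≠ 0 := by positivity
  -- The `g^{ij}`-trace of C-reducibility reads `(n+1) c_k = (n-1) c_k + 2 (c_k - ℓ_k (y·c)/F)`, so
  -- `ℓ_k (y·c) = 0`; contracting with `y` then gives `y·c = 0`.
  have key : ∀ k, supportElt F x y k * (((y : Fin n → ℝ) ⬝ᵥ c) / onFibre F x y) = 0 := by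
    intro k
    have e : c k = ∑ i, ∑ j, cartan F x y i j k * inverseMetric F x y i j := rfl
    have e2 : ∑ i, ∑ j, cartan F x y i j k * inverseMetric F x y i j = 1 / ((n : ℝ) + 1) *
        (∑ i, ∑ j, angularMetric F x y i j * inverseMetric F x y i j * c k
          + ∑ i, ∑ j, angularMetric F x y k j * inverseMetric F x y i j * c i
          + ∑ i, ∑ j, angularMetric F x y k i * inverseMetric F x y i j * c j) := by
      simp only [Finset.mul_sum, ← Finset.sum_add_distrib]
      refine Finset.sum_congr rfl fun i _ => Finset.sum_congr rfl fun j _ => ?_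
      rw [hC x y hy, hF.angularMetric_comm hy j k]; ring
    have e3 : ∑ i, ∑ j, angularMetric F x y k i * inverseMetric F x y i j * c j =
        c k - supportElt F x y k * (((y : Fin n → ℝ) ⬝ᵥ c) / onFibre F x y) := by
      rw [← hB, toBilin'_apply]; rfl
    have e4 : ∑ i, ∑ j, angularMetric F x y k j * inverseMetric F x y i j * c i =
        c k - supportElt F x y k * (((y : Fin n → ℝ) ⬝ᵥ c) / onFibre F x y) := by
      rw [← hB, toBilin'_comm (hF.isSymm_inverse hy), toBilin'_apply]
      exact Finset.sum_congr rfl fun i _ => Finset.sum_congr rfl fun j _ => by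
        rw [inverseMetric]; ring
    have e5 : ∑ i, ∑ j, angularMetric F x y i j * inverseMetric F x y i j * c k =
        (n - 1) * c k := by
      simp only [← Finset.sum_mul, hF.sum_angularMetric_inverseMetric hy]
    rw [e2, e3, e4, e5] at e
    field_simp at e ⊢
    linarith
  have h := hF.sum_supportElt_mul (x := x) hy
  have hf := hF.onFibre_ne_zero (x := x) hy
  have h2 : onFibre F x y * (((y : Fin n → ℝ) ⬝ᵥ c) / onFibre F x y) = 0 := by
    nth_rewrite 1 [← h]
    rw [Finset.sum_mul]
    refine Finset.sum_eq_zero fun k _ => ?_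
    rw [mul_right_comm, key, zero_mul]
  rw [mul_div_cancel₀ _ hf, dotProduct_comm] at h2
  exact h2

theorem sum_partialY_meanCartan_mul (hC : IsCReducible F) (hy : y ≠ 0) (k : Fin n) :
    ∑ r, partialY k (fun z => meanCartan F x z r) y * y r = - meanCartan F x y k := by
  have e := partialY_congr_slit (i := k) hy (fun z hz => hF.sum_meanCartan_mul (x := x) hC hz)
  rw [partialY_sum_mul_coord
    (fun r => differentiableAt_of_slit (hF.contDiffOn_meanCartan x r) hy), partialY_const] at e
  linarith

end IsFinslerStructure
end Fibre

/-! ### Reduction of the T-tensor to a two-index tensor -/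

section Reduction

open Matrix

variable {n : ℕ} {M : Type*} [TopologicalSpace M] [ChartedSpace (Coord n) M]
  [IsManifold (𝓡 n) ∞ M] {F : TangentBundle (𝓡 n) M → ℝ}

/-- The square `g^{ij} C_i C_j` of the length of the mean Cartan covector. -/
def meanCartanSq (F : TangentBundle (𝓡 n) M → ℝ) (x : M) (y : Coord n) : ℝ :=
  ∑ i, ∑ j, meanCartan F x y i * inverseMetric F x y i j * meanCartan F x y j

/-- The tensor `A_{jk}` such that `(n + 1) T_{rijk} = h_{ri} A_{jk} + h_{ij} A_{rk} + h_{jr} A_{ik}`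
for a C-reducible structure. -/
def reducedTensor (F : TangentBundle (𝓡 n) M → ℝ) (x : M) (y : Coord n) :
    Matrix (Fin n) (Fin n) ℝ :=
  Matrix.of fun j k =>
    onFibre F x y * partialY k (fun z => meanCartan F x z j) y
      + supportElt F x y k * meanCartan F x y j + supportElt F x y j * meanCartan F x y k
      - onFibre F x y / ((n : ℝ) + 1) * (2 * meanCartan F x y j * meanCartan F x y k
        + meanCartanSq F x y * angularMetric F x y j k)

namespace IsFinslerStructure

variable (hF : IsFinslerStructure F) (x : M)

include hF

theorem contDiffOn_meanCartanSq :
    ContDiffOn ℝ ∞ (fun z => meanCartanSq F x z) {0}ᶜ :=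
  ContDiffOn.sum fun i _ => ContDiffOn.sum fun j _ =>
    ((hF.contDiffOn_meanCartan x i).mul (hF.contDiffOn_inverseMetric x i j)).mul
      (hF.contDiffOn_meanCartan x j)

theorem contDiffOn_reducedTensor (j k : Fin n) :
    ContDiffOn ℝ ∞ (fun z => reducedTensor F x z j k) {0}ᶜ := by
  have hf := hF.contDiffOn_onFibre x
  have hl := hF.contDiffOn_supportElt x
  have hc := hF.contDiffOn_meanCartan x
  exact (((hf.mul (contDiffOn_partialY (hc j) k)).add ((hl k).mul (hc j))).add
    ((hl j).mul (hc k))).sub ((hf.div_const _).mul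
      (((contDiffOn_const.mul (hc j)).mul (hc k)).add
        ((hF.contDiffOn_meanCartanSq x).mul (hF.contDiffOn_angularMetric x j k))))

variable {x} {y : Coord n}

/-- Product rule on the C-reducible form, left in the shape that `tTensor_algebra` takes. -/
theorem cartanDeriv_eq (hC : IsCReducible F) (hy : y ≠ 0) (r i j k : Fin n) :
    cartanDeriv F x y r i j k = 1 / ((n : ℝ) + 1) *
      (((2 * cartan F x y r i k - (supportElt F x y r * angularMetric F x y i k
          + supportElt F x y i * angularMetric F x y r k) / onFibre F x y) * meanCartan F x y j
          + angularMetric F x y r i * partialY k (fun z => meanCartan F x z j) y)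
        + ((2 * cartan F x y i j k - (supportElt F x y i * angularMetric F x y j k
          + supportElt F x y j * angularMetric F x y i k) / onFibre F x y) * meanCartan F x y r
          + angularMetric F x y i j * partialY k (fun z => meanCartan F x z r) y)
        + ((2 * cartan F x y j r k - (supportElt F x y j * angularMetric F x y r k
          + supportElt F x y r * angularMetric F x y j k) / onFibre F x y) * meanCartan F x y i
          + angularMetric F x y j r * partialY k (fun z => meanCartan F x z i) y)) := by
  have hh : ∀ a b, DifferentiableAt ℝ (fun z => angularMetric F x z a b) y := fun a b =>
    differentiableAt_of_slit (hF.contDiffOn_angularMetric x a b) hy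
  have hc : ∀ a, DifferentiableAt ℝ (fun z => meanCartan F x z a) y := fun a =>
    differentiableAt_of_slit (hF.contDiffOn_meanCartan x a) hy
  have hp : ∀ a b d, DifferentiableAt ℝ
      (fun z => angularMetric F x z a b * meanCartan F x z d) y := fun a b d =>
    (hh a b).fun_mul (hc d)
  rw [cartanDeriv, partialY_congr_slit hy fun z hz => hC x z hz r i j,
    partialY_const_mul _ (((hp r i j).fun_add (hp i j r)).fun_add (hp j r i)),
    partialY_add ((hp r i j).fun_add (hp i j r)) (hp j r i), partialY_add (hp r i j) (hp i j r),
    partialY_mul (hh r i) (hc j), partialY_mul (hh i j) (hc r), partialY_mul (hh j r) (hc i)]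
  simp only [hF.partialY_angularMetric hy]
  ring

theorem dotProduct_meanCartan (hC : IsCReducible F) (hy : y ≠ 0) :
    (y : Fin n → ℝ) ⬝ᵥ meanCartan F x y = 0 := by
  rw [dotProduct_comm]; exact hF.sum_meanCartan_mul hC hy

theorem toBilin'_angularMetric_of_orthogonal (hy : y ≠ 0) (i : Fin n) {v : Fin n → ℝ}
    (hv : (y : Fin n → ℝ) ⬝ᵥ v = 0) :
    toBilin' (metricMatrix F x y)⁻¹ (angularMetric F x y i) v = v i := by
  rw [hF.toBilin'_angularMetric hy, hv, zero_div, mul_zero, sub_zero]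

/-- The T-tensor of a C-reducible structure. -/
theorem tTensor_eq (hC : IsCReducible F) (hy : y ≠ 0) (r i j k : Fin n) :
    tTensor F x y r i j k = 1 / ((n : ℝ) + 1) *
      (angularMetric F x y r i * reducedTensor F x y j k
        + angularMetric F x y i j * reducedTensor F x y r k
        + angularMetric F x y j r * reducedTensor F x y i k) := by
  have hN : (n : ℝ) + 1 ≠ 0 := by positivity
  have Bhc := fun i => hF.toBilin'_angularMetric_of_orthogonal (x := x) hy i
    (hF.dotProduct_meanCartan (x := x) hC hy)
  have key := tTensor_algebra (toBilin' (metricMatrix F x y)⁻¹) (angularMetric F x y)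
    (fun a b => partialY b (fun z => meanCartan F x z a) y) (meanCartan F x y) (supportElt F x y)
    (onFibre F x y) ((n : ℝ) + 1) hN (hF.onFibre_ne_zero hy) (hF.angularMetric_comm hy)
    (fun i j => by
      rw [hF.toBilin'_angularMetric_of_orthogonal hy, hF.angularMetric_comm hy]
      rw [dotProduct_comm]; exact hF.sum_angularMetric_mul hy j)
    Bhc (fun i => by rw [toBilin'_comm (hF.isSymm_inverse hy), Bhc])
    (cartan F x y) (hC x y hy) r i j k
  have hB : ∀ a b p q, toBilin' (metricMatrix F x y)⁻¹ (cartan F x y a b)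
      (fun s => cartan F x y s p q) = ∑ s, cartan F x y s p q * cartanUp F x y s a b := by
    intro a b p q
    rw [toBilin'_apply, Finset.sum_comm]
    refine Finset.sum_congr rfl fun s _ => ?_
    rw [cartanUp, Finset.mul_sum]
    exact Finset.sum_congr rfl fun m _ => by rw [inverseMetric]; ring
  have hSq : toBilin' (metricMatrix F x y)⁻¹ (meanCartan F x y) (meanCartan F x y) =
      meanCartanSq F x y := toBilin'_apply _ _ _
  simp only [hB, hSq] at key
  rw [tTensor, hF.cartanDeriv_eq hC hy]
  simp only [Finset.sum_add_distrib]
  rw [key]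
  rfl

/-- The derivative term contributes `-F c_k` and the term with `ℓ_r y^r = F` contributes `F c_k`;
the rest is orthogonal to `y`. This is the orthogonality needed in `eq_zero_of_contraction`. -/
theorem sum_reducedTensor_mul (hC : IsCReducible F) (hy : y ≠ 0) (k : Fin n) :
    ∑ r, reducedTensor F x y r k * y r = 0 := by
  have h1 := hF.sum_partialY_meanCartan_mul (x := x) hC hy k
  have h2 := hF.sum_meanCartan_mul (x := x) hC hy
  have h3 := hF.sum_supportElt_mul (x := x) hy
  have h4 : ∑ r, angularMetric F x y r k * y r = 0 := by
    simp only [hF.angularMetric_comm hy _ k]; exact hF.sum_angularMetric_mul hy k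
  have e : ∑ r, reducedTensor F x y r k * y r =
      onFibre F x y * ∑ r, partialY k (fun z => meanCartan F x z r) y * y r
      + supportElt F x y k * ∑ r, meanCartan F x y r * y r
      + meanCartan F x y k * ∑ r, supportElt F x y r * y r
      - onFibre F x y / ((n : ℝ) + 1) * (2 * meanCartan F x y k * ∑ r, meanCartan F x y r * y r
        + meanCartanSq F x y * ∑ r, angularMetric F x y r k * y r) := by
    simp only [Finset.mul_sum, ← Finset.sum_add_distrib, ← Finset.sum_sub_distrib]
    refine Finset.sum_congr rfl fun r _ => ?_
    rw [reducedTensor, of_apply]; ring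
  rw [e, h1, h2, h3, h4]; ring

/-- Where `s` is not proportional to `ℓ`, the condition `s_r T^r_{jkh} = 0` kills the T-tensor. -/
theorem reducedTensor_eq_zero (hC : IsCReducible F) (hy : y ≠ 0) {s : Fin n → ℝ}
    (hT : ∀ j k h, ∑ r, s r * tTensorUp F x y r j k h = 0)
    (hs : ∃ i, onFibre F x y * s i ≠ supportElt F x y i * ∑ r, s r * y r) :
    reducedTensor F x y = 0 := by
  have hf := hF.onFibre_ne_zero (x := x) hy
  set U : Fin n → ℝ := fun r => ∑ a, s a * inverseMetric F x y a r with hU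
  -- This is the angular part of `s`; it vanishes exactly when `F s = (s·y) ℓ`, which `hs` excludes.
  have hw : ∀ i, ∑ r, U r * angularMetric F x y r i =
      s i - supportElt F x y i * (((y : Fin n → ℝ) ⬝ᵥ s) / onFibre F x y) := by
    intro i
    rw [← hF.toBilin'_angularMetric hy, toBilin'_comm (hF.isSymm_inverse hy), toBilin'_apply,
      Finset.sum_comm]
    refine Finset.sum_congr rfl fun r _ => ?_
    rw [hU, Finset.sum_mul]
    exact Finset.sum_congr rfl fun a _ => by rw [hF.angularMetric_comm hy]; rfl
  refine eq_zero_of_contraction (U := U) (h := of (angularMetric F x y))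
    (w := fun i => ∑ r, U r * angularMetric F x y r i) (hF.isUnit_det hy)
    (hF.isSymm_metricMatrix hy) hf (hF.metricMatrix_mulVec hy) (hF.supportElt_dotProduct hy)
    (fun i j => rfl) (hF.sum_reducedTensor_mul hC hy) (fun i => rfl) ?_ ?_
  · obtain ⟨i, hi⟩ := hs
    intro h0
    apply hi
    have := congrFun h0 i
    simp only [hw, Pi.zero_apply] at this
    have e : (y : Fin n → ℝ) ⬝ᵥ s = ∑ r, s r * y r := by rw [dotProduct_comm]; rfl
    rw [e] at this
    field_simp at this
    linarith
  · intro i j k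
    have h1 : ∑ r, U r * tTensor F x y r i j k = 0 := by
      rw [← hT i j k]
      simp only [hU, tTensorUp, Finset.sum_mul, Finset.mul_sum]
      rw [Finset.sum_comm]
      exact Finset.sum_congr rfl fun a _ => Finset.sum_congr rfl fun r _ => by ring
    have hN : (n : ℝ) + 1 ≠ 0 := by positivity
    have h2 : ∑ r, U r * tTensor F x y r i j k = 1 / ((n : ℝ) + 1) *
        ∑ r, U r * (angularMetric F x y r i * reducedTensor F x y j k
        + angularMetric F x y i j * reducedTensor F x y r k
        + angularMetric F x y j r * reducedTensor F x y i k) := by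
      rw [Finset.mul_sum]
      exact Finset.sum_congr rfl fun r _ => by rw [hF.tTensor_eq hC hy]; ring
    rw [h1] at h2
    have h3 := (mul_eq_zero.1 h2.symm).resolve_left (one_div_ne_zero hN)
    exact h3

/-- A nonzero covector is not proportional to `ℓ` on an open set of directions. -/
theorem covector_eq_zero_of_eventually (hn : 2 ≤ n) (hy : y ≠ 0) {s : Fin n → ℝ}
    (h : ∀ᶠ z in nhds y, ∀ i, onFibre F x z * s i = supportElt F x z i * ∑ r, s r * z r) :
    s = 0 := by
  have hf := hF.onFibre_ne_zero (x := x) hy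
  have hdf : DifferentiableAt ℝ (onFibre F x) y :=
    differentiableAt_of_slit (hF.contDiffOn_onFibre x) hy
  have hdl := fun i => differentiableAt_of_slit (hF.contDiffOn_supportElt x i) hy
  have hds : DifferentiableAt ℝ (fun z : Coord n => ∑ r, s r * z r) y :=
    DifferentiableAt.fun_sum fun r _ => (differentiableAt_coord r).const_mul _
  have h0 := h.self_of_nhds
  set b := ∑ r, s r * y r with hb
  -- The `j`-derivative of `F s_i = ℓ_i (s·z)` is `ℓ_j s_i = b h_{ij} / F + ℓ_i s_j`. Since `F s = b
  -- ℓ` at `y`, the terms in `s` cancel.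
  have key : ∀ i j, b * angularMetric F x y i j = 0 := by
    intro i j
    have e : partialY j (fun z => onFibre F x z * s i) y =
        partialY j (fun z => supportElt F x z i * ∑ r, s r * z r) y :=
      partialY_congr (h.mono fun z hz => hz i)
    have e1 : partialY j (fun z : Coord n => ∑ r, s r * z r) y = s j := by
      rw [partialY_sum_mul_coord (w := fun r _ => s r) (fun r => differentiableAt_const _)]
      simp [partialY_const]
    rw [partialY_mul hdf (differentiableAt_const _), partialY_const,
      partialY_mul (hdl i) hds, e1, hF.partialY_supportElt hy] at e
    have e2 : partialY j (onFibre F x) y = supportElt F x y j := rfl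
    have hi := h0 i
    have hj := h0 j
    rw [e2, ← hb] at e
    field_simp at e
    linear_combination (-1 : ℝ) * e + supportElt F x y j * hi - supportElt F x y i * hj
  -- The trace of `h` is `n - 1`, nonzero because `n ≥ 2`.
  have hb0 : b = 0 := by
    have h1 : b * ∑ i, ∑ j, angularMetric F x y i j * inverseMetric F x y i j = 0 := by
      simp only [Finset.mul_sum, ← mul_assoc, key, zero_mul, Finset.sum_const_zero]
    rw [hF.sum_angularMetric_inverseMetric hy] at h1
    have : (n : ℝ) - 1 ≠ 0 := by
      have : (2 : ℝ) ≤ n := by exact_mod_cast hn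
      linarith
    exact (mul_eq_zero.1 h1).resolve_right this
  funext i
  have := h0 i
  rw [hb0, mul_zero] at this
  exact (mul_eq_zero.1 this).resolve_left hf

theorem reducedTensor_eq_zero_of_covector (hn : 2 ≤ n) (hC : IsCReducible F) {s : Fin n → ℝ}
    (hs : s ≠ 0)
    (hT : ∀ z : Coord n, z ≠ 0 → ∀ j k h, ∑ r, s r * tTensorUp F x z r j k h = 0) (hy : y ≠ 0) :
    reducedTensor F x y = 0 := by
  ext j k
  by_contra hA
  apply hs
  refine hF.covector_eq_zero_of_eventually (x := x) hn hy ?_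
  filter_upwards [(continuousAt_of_slit (hF.contDiffOn_reducedTensor x j k) hy).eventually_ne hA,
    slit_mem_nhds hy] with z hz hz0
  by_contra! hne
  exact hz (by rw [hF.reducedTensor_eq_zero hC hz0 (hT z hz0) hne])

end IsFinslerStructure
end Reduction

/-! ### From a vanishing reduced tensor to a Riemannian fibre -/

section Rigidity

open Matrix

variable {n : ℕ} {M : Type*} [TopologicalSpace M] [ChartedSpace (Coord n) M]
  [IsManifold (𝓡 n) ∞ M] {F : TangentBundle (𝓡 n) M → ℝ}

namespace IsFinslerStructure

variable (hF : IsFinslerStructure F) {x : M} {y : Coord n}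

include hF

theorem metricMatrix_smul {c : ℝ} (hc : 0 < c) (hy : y ≠ 0) :
    metricMatrix F x (c • y) = metricMatrix F x y := by
  have hsq := (hF.contDiffOn_onFibre x).pow 2
  ext i j
  have h1 : ∀ z : Coord n, z ≠ 0 → partialY j (fun w => onFibre F x w ^ 2) (c • z) =
      c ^ 1 * partialY j (fun w => onFibre F x w ^ 2) z := by
    intro z hz
    have := mul_partialY_smul (u := fun w => onFibre F x w ^ 2) (m := 2) (c := c)
      (fun w _ => by rw [hF.onFibre_smul hc, mul_pow]) hz (differentiableAt_of_slit hsq hz) j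
    have hc' := hc.ne'
    apply mul_left_cancel₀ hc'
    rw [this]; ring
  have h2 := mul_partialY_smul h1 hy (differentiableAt_of_slit (contDiffOn_partialY hsq j) hy) i
  rw [pow_one] at h2
  rw [metricMatrix, metricMatrix, of_apply, of_apply, mul_left_cancel₀ hc.ne' h2]

/-- The determinant of the metric has a critical point on each tangent space, and there the mean
Cartan covector vanishes. -/
theorem exists_meanCartan_eq_zero (hn : 2 ≤ n) (x : M) :
    ∃ y : Coord n, y ≠ 0 ∧ ∀ k, meanCartan F x y k = 0 := by
  have hdet : ContDiffOn ℝ ∞ (fun z => (metricMatrix F x z).det) {0}ᶜ :=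
    contDiffOn_det (hF.contDiffOn_metricMatrix x)
  have hsub : Metric.sphere (0 : Coord n) 1 ⊆ {0}ᶜ := fun z hz => by
    rintro rfl
    simp at hz
  have hne : (Metric.sphere (0 : Coord n) 1).Nonempty :=
    ⟨EuclideanSpace.single ⟨0, by omega⟩ 1, by simp⟩
  obtain ⟨y₀, hy₀, hmax⟩ := (isCompact_sphere (0 : Coord n) 1).exists_isMaxOn hne
    (hdet.continuousOn.mono hsub)
  have hy₀' : y₀ ≠ 0 := hsub hy₀
  refine ⟨y₀, hy₀', fun k => ?_⟩
  -- Homogeneity of degree 0 makes the maximum on the sphere a maximum over all nonzero vectors.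
  have hloc : IsLocalMax (fun z => (metricMatrix F x z).det) y₀ := by
    filter_upwards [slit_mem_nhds hy₀'] with z hz
    have hz' : z ≠ 0 := hz
    have h1 : 0 < ‖z‖⁻¹ := inv_pos.2 (norm_pos_iff.2 hz')
    rw [← hF.metricMatrix_smul h1 hz']
    exact hmax (by simp [norm_smul, hz'])
  have hJ := partialY_det (g := metricMatrix F x) (y := y₀)
    (fun i j => differentiableAt_of_slit (hF.contDiffOn_metricMatrix x i j) hy₀')
    (hF.posDef x y₀ hy₀').det_pos.ne' k
  have h0 : partialY k (fun z => (metricMatrix F x z).det) y₀ = 0 := by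
    rw [partialY, hloc.fderiv_eq_zero]; rfl
  rw [h0] at hJ
  have h3 := (mul_eq_zero.1 hJ.symm).resolve_left (hF.posDef x y₀ hy₀').det_pos.ne'
  have h4 : meanCartan F x y₀ k =
      1 / 2 * ∑ i, ∑ j, partialY k (fun z => metricMatrix F x z i j) y₀ *
        (metricMatrix F x y₀)⁻¹ j i := by
    rw [meanCartan]
    simp only [Finset.mul_sum]
    refine Finset.sum_congr rfl fun i _ => Finset.sum_congr rfl fun j _ => ?_
    rw [cartan, inverseMetric, (hF.isSymm_inverse hy₀').apply, mul_assoc]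
  rw [h4, h3, mul_zero]

/-- The derivative of `C² = g^{ij} C_i C_j`. -/
theorem partialY_meanCartanSq (hy : y ≠ 0) (k : Fin n) :
    partialY k (fun z => meanCartanSq F x z) y =
      2 * ∑ i, (∑ j, inverseMetric F x y i j * meanCartan F x y j) *
          partialY k (fun z => meanCartan F x z i) y
        - 2 * ∑ i, ∑ j, cartan F x y i j k *
          (∑ a, inverseMetric F x y i a * meanCartan F x y a) *
          (∑ a, inverseMetric F x y j a * meanCartan F x y a) := by
  -- With `v = g⁻¹ c`, differentiating `c = g v` and `C² = c·v` avoids differentiating the inverse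
  -- matrix.
  let v : Coord n → Fin n → ℝ := fun z i => ∑ j, inverseMetric F x z i j * meanCartan F x z j
  have hv : ∀ i, ContDiffOn ℝ ∞ (fun z => v z i) {0}ᶜ := fun i => ContDiffOn.sum fun j _ =>
    (hF.contDiffOn_inverseMetric x i j).mul (hF.contDiffOn_meanCartan x j)
  have dv := fun i => differentiableAt_of_slit (hv i) hy
  have dc := fun i => differentiableAt_of_slit (hF.contDiffOn_meanCartan x i) hy
  have dg := fun i j => differentiableAt_of_slit (hF.contDiffOn_metricMatrix x i j) hy
  have hlow : ∀ z : Coord n, z ≠ 0 → ∀ i,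
      meanCartan F x z i = ∑ j, metricMatrix F x z i j * v z j := by
    intro z hz i
    have : metricMatrix F x z *ᵥ ((metricMatrix F x z)⁻¹ *ᵥ meanCartan F x z) =
        meanCartan F x z := by
      rw [mulVec_mulVec, mul_nonsing_inv _ (hF.isUnit_det hz), one_mulVec]
    exact (congrFun this i).symm
  have hsq : ∀ z, meanCartanSq F x z = ∑ i, meanCartan F x z i * v z i := by
    intro z
    rw [meanCartanSq]
    refine Finset.sum_congr rfl fun i _ => ?_
    simp only [v, Finset.mul_sum, mul_assoc]
  have e1 : partialY k (fun z => meanCartanSq F x z) y =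
      ∑ i, meanCartan F x y i * partialY k (fun z => v z i) y
        + ∑ i, v y i * partialY k (fun z => meanCartan F x z i) y := by
    simp only [hsq]
    rw [partialY_sum fun i _ => (dc i).fun_mul (dv i), ← Finset.sum_add_distrib]
    exact Finset.sum_congr rfl fun i _ => partialY_mul (dc i) (dv i)
  have e2 : ∀ i, partialY k (fun z => meanCartan F x z i) y =
      ∑ j, (metricMatrix F x y i j * partialY k (fun z => v z j) y
        + v y j * (2 * cartan F x y i j k)) := by
    intro i
    rw [partialY_congr_slit hy fun z hz => hlow z hz i,
      partialY_sum fun j _ => (dg i j).fun_mul (dv j)]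
    refine Finset.sum_congr rfl fun j _ => ?_
    rw [partialY_mul (dg i j) (dv j), cartan]
    ring
  -- This trades `c·∂v` for `v·∂c`, at the cost of `2 C(v, v)`.
  have e3 : ∑ i, v y i * partialY k (fun z => meanCartan F x z i) y =
      ∑ i, meanCartan F x y i * partialY k (fun z => v z i) y
        + 2 * ∑ i, ∑ j, cartan F x y i j k * v y i * v y j := by
    have e4 : ∑ i, meanCartan F x y i * partialY k (fun z => v z i) y =
        ∑ i, ∑ j, v y i * metricMatrix F x y i j * partialY k (fun z => v z j) y := by
      rw [Finset.sum_comm]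
      refine Finset.sum_congr rfl fun i _ => ?_
      rw [hlow y hy, Finset.sum_mul]
      refine Finset.sum_congr rfl fun j _ => ?_
      rw [(hF.isSymm_metricMatrix hy).apply j i, mul_comm (v y j)]
    rw [e4, Finset.mul_sum, ← Finset.sum_add_distrib]
    refine Finset.sum_congr rfl fun i _ => ?_
    rw [e2, Finset.mul_sum, Finset.mul_sum, ← Finset.sum_add_distrib]
    exact Finset.sum_congr rfl fun j _ => by ring
  change _ = 2 * ∑ i, v y i * partialY k (fun z => meanCartan F x z i) y
    - 2 * ∑ i, ∑ j, cartan F x y i j k * v y i * v y j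
  rw [e1]; linarith

/-- If the T-tensor vanishes, then `F² C²` is constant on the tangent space. -/
theorem partialY_sq_mul_meanCartanSq (hC : IsCReducible F) (hy : y ≠ 0)
    (hA : reducedTensor F x y = 0) (k : Fin n) :
    partialY k (fun z => onFibre F x z ^ 2 * meanCartanSq F x z) y = 0 := by
  have hf := hF.onFibre_ne_zero (x := x) hy
  have hN : (n : ℝ) + 1 ≠ 0 := by positivity
  have df : DifferentiableAt ℝ (onFibre F x) y :=
    differentiableAt_of_slit (hF.contDiffOn_onFibre x) hy
  have dq := differentiableAt_of_slit (hF.contDiffOn_meanCartanSq x) hy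
  set c := meanCartan F x y with hc
  set Q := meanCartanSq F x y with hQ
  set f := onFibre F x y
  set l := supportElt F x y
  set v : Fin n → ℝ := fun i => ∑ j, inverseMetric F x y i j * meanCartan F x y j with hv
  have hyc := hF.dotProduct_meanCartan (x := x) hC hy
  have vB : ∀ u : Fin n → ℝ, ∑ i, u i * v i = toBilin' (metricMatrix F x y)⁻¹ u c := by
    intro u
    rw [toBilin'_apply]
    refine Finset.sum_congr rfl fun i _ => ?_
    rw [hv, Finset.mul_sum]
    exact Finset.sum_congr rfl fun j _ => (mul_assoc _ _ _).symm
  have vc : ∑ i, c i * v i = Q := by rw [vB, toBilin'_apply]; rfl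
  have vl : ∑ i, l i * v i = 0 := by rw [vB, hF.toBilin'_supportElt hy, hyc, zero_div]
  have vh : ∀ j, ∑ i, angularMetric F x y j i * v i = c j := fun j => by
    rw [vB, hF.toBilin'_angularMetric_of_orthogonal hy j hyc]
  have hD : ∀ i, f * partialY k (fun z => meanCartan F x z i) y =
      f / ((n : ℝ) + 1) * (2 * c i * c k + Q * angularMetric F x y k i) - l k * c i - l i * c k := by
    intro i
    have := congrFun (congrFun hA i) k
    rw [reducedTensor, of_apply, Matrix.zero_apply, hF.angularMetric_comm hy i k] at this
    linarith
  have s1 : f * ∑ i, v i * partialY k (fun z => meanCartan F x z i) y =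
      f / ((n : ℝ) + 1) * (3 * Q * c k) - l k * Q := by
    have : f * ∑ i, v i * partialY k (fun z => meanCartan F x z i) y =
        f / ((n : ℝ) + 1) * (2 * c k * ∑ i, c i * v i
          + Q * ∑ i, angularMetric F x y k i * v i) - l k * ∑ i, c i * v i
          - c k * ∑ i, l i * v i := by
      simp only [Finset.mul_sum, ← Finset.sum_add_distrib, ← Finset.sum_sub_distrib]
      exact Finset.sum_congr rfl fun i _ => by linear_combination v i * hD i
    rw [this, vc, vl, vh]; ring
  have s2 : ∑ i, ∑ j, cartan F x y i j k * v i * v j = 1 / ((n : ℝ) + 1) * (3 * Q * c k) := by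
    have : ∀ i, ∑ j, cartan F x y i j k * v i * v j = 1 / ((n : ℝ) + 1) *
        (v i * c k * ∑ j, angularMetric F x y i j * v j
          + c i * v i * ∑ j, angularMetric F x y k j * v j
          + angularMetric F x y k i * v i * ∑ j, c j * v j) := by
      intro i
      simp only [Finset.mul_sum, ← Finset.sum_add_distrib]
      refine Finset.sum_congr rfl fun j _ => ?_
      rw [hC x y hy, hF.angularMetric_comm hy j k]; ring
    simp only [this, vh, vc]
    rw [← Finset.mul_sum, Finset.sum_add_distrib, Finset.sum_add_distrib, ← Finset.sum_mul,
      ← Finset.sum_mul, vc, vh]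
    have : ∑ i, v i * c k * c i = Q * c k := by
      rw [← vc, Finset.sum_mul]; exact Finset.sum_congr rfl fun i _ => by ring
    rw [this]; ring
  have s3 : partialY k (fun z => meanCartanSq F x z) y =
      2 * ∑ i, v i * partialY k (fun z => meanCartan F x z i) y
        - 2 * ∑ i, ∑ j, cartan F x y i j k * v i * v j := hF.partialY_meanCartanSq hy k
  -- The cubic terms `3 C² c_k` in `s1` and `s2` cancel, leaving `F ∂_k C² = -2 ℓ_k C²`, which says
  -- that `F² C²` has zero derivative.
  have s4 : f * partialY k (fun z => meanCartanSq F x z) y = - 2 * l k * Q := by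
    rw [s3, s2, mul_sub, mul_left_comm, s1]
    ring
  have s5 : partialY k (fun z => onFibre F x z ^ 2) y = 2 * (f * l k) := by
    simp only [pow_two]
    rw [partialY_mul df df]
    change f * l k + f * l k = _
    ring
  rw [partialY_mul (df.fun_pow 2) dq, s5]
  change f ^ 2 * _ + Q * _ = 0
  linear_combination f * s4

/-- If the T-tensor vanishes on a tangent space, then `F` is Riemannian there. -/
theorem isRiemannianAt_of_reducedTensor (hn : 2 ≤ n) (hC : IsCReducible F)
    (hA : ∀ y : Coord n, y ≠ 0 → reducedTensor F x y = 0) : IsRiemannianAt F x := by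
  obtain ⟨y₀, hy₀, hc₀⟩ := hF.exists_meanCartan_eq_zero hn x
  have hsq : ∀ y : Coord n, y ≠ 0 → meanCartanSq F x y = 0 := by
    intro y hy
    have hconst := eq_of_partialY_eq_zero hn
      (((hF.contDiffOn_onFibre x).pow 2).mul (hF.contDiffOn_meanCartanSq x))
      (fun z hz k => hF.partialY_sq_mul_meanCartanSq hC hz (hA z hz) k) hy hy₀
    have h0 : meanCartanSq F x y₀ = 0 := by simp [meanCartanSq, hc₀]
    simp only [h0, mul_zero] at hconst
    exact (mul_eq_zero.1 hconst).resolve_left (pow_ne_zero 2 (hF.onFibre_ne_zero hy))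
  have hc : ∀ y : Coord n, y ≠ 0 → meanCartan F x y = 0 := by
    intro y hy
    by_contra hne
    have hpos := (hF.posDef x y hy).inv.dotProduct_mulVec_pos hne
    have e : meanCartanSq F x y =
        meanCartan F x y ⬝ᵥ (metricMatrix F x y)⁻¹ *ᵥ meanCartan F x y := by
      rw [← toBilin'_apply', toBilin'_apply]; rfl
    rw [star_trivial, ← e, hsq y hy] at hpos
    exact lt_irrefl _ hpos
  have hg : ∀ y : Coord n, y ≠ 0 → metricMatrix F x y = metricMatrix F x y₀ := by
    intro y hy
    ext i j
    refine eq_of_partialY_eq_zero (u := fun z => metricMatrix F x z i j) hn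
      (hF.contDiffOn_metricMatrix x i j) (fun z hz k => ?_) hy hy₀
    have h1 : cartan F x z i j k = 0 := by rw [hC x z hz, hc z hz]; simp
    rw [cartan] at h1
    simpa using h1
  -- Once `g` is constant, Euler's identity gives `F² = g_{ij} y^i y^j` with the value of `g` at
  -- `y₀`.
  let Q : QuadraticForm ℝ (Coord n) := (metricMatrix F x y₀).toQuadraticForm'.comp
    (WithLp.linearEquiv 2 ℝ (Fin n → ℝ)).toLinearMap
  have hQ : ∀ y : Coord n, onFibre F x y ^ 2 = Q y := by
    intro y
    have e : Q y = (y : Fin n → ℝ) ⬝ᵥ metricMatrix F x y₀ *ᵥ (y : Fin n → ℝ) := by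
      simp [Q, toQuadraticForm', toLinearMap₂'_apply']
    rw [e]
    by_cases hy : y = 0
    · have : onFibre F x y = 0 := (hF.eq_zero_iff ⟨x, y⟩).2 hy
      rw [this, hy]; simp
    · rw [← hg y hy, hF.metricMatrix_mulVec hy, dotProduct_smul, dotProduct_comm,
        hF.supportElt_dotProduct hy, smul_eq_mul, pow_two]
  exact ⟨Q, hQ⟩

theorem mfderiv_eq_zero (hn : 2 ≤ n) (hC : IsCReducible F) {σ : M → ℝ}
    (hσ : SigmaTVanishesAt F σ x) (hR : ¬ IsRiemannianAt F x) :
    mfderiv (𝓡 n) 𝓘(ℝ, ℝ) σ x = 0 := by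
  apply mfderiv_eq_zero_of_gradComp
  by_contra! hne
  obtain ⟨r, hr⟩ := hne
  have hs : gradComp (n := n) σ x ≠ 0 := fun h => hr (congrFun h r)
  exact hR (hF.isRiemannianAt_of_reducedTensor hn hC fun y hy =>
    hF.reducedTensor_eq_zero_of_covector hn hC hs hσ hy)

end IsFinslerStructure
end Rigidity

end FinslerGeometry

end

theorem mainTheorem5 {n : ℕ} (hn : 2 ≤ n) {M : Type*} [TopologicalSpace M]
    [ChartedSpace (EuclideanSpace ℝ (Fin n)) M] [IsManifold (𝓡 n) ∞ M]
    (F : TangentBundle (𝓡 n) M → ℝ)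
    (hF : FinslerGeometry.IsFinslerStructure F) (hC : FinslerGeometry.IsCReducible F) :
    (ConnectedSpace M → (∀ x : M, ¬ FinslerGeometry.IsRiemannianAt F x) →
      ¬ ∃ σ : M → ℝ, ContMDiff (𝓡 n) 𝓘(ℝ, ℝ) ∞ σ ∧ (¬ ∃ c : ℝ, ∀ x : M, σ x = c) ∧
        ∀ x : M, FinslerGeometry.SigmaTVanishesAt F σ x) ∧
    (∀ σ : M → ℝ, ContMDiff (𝓡 n) 𝓘(ℝ, ℝ) ∞ σ →
      ∀ x : M, FinslerGeometry.SigmaTVanishesAt F σ x →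
        ¬ FinslerGeometry.IsRiemannianAt F x → mfderiv (𝓡 n) 𝓘(ℝ, ℝ) σ x = 0) := by
  refine ⟨?_, fun σ _ x hσ hR => hF.mfderiv_eq_zero hn hC hσ hR⟩
  rintro hconn hR ⟨σ, hσ, hnc, hT⟩
  exact hnc (FinslerGeometry.exists_eq_const_of_mfderiv_eq_zero hσ
    fun x => hF.mfderiv_eq_zero hn hC (hT x) (hR x))
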